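/- Let $X_1,X_2,\dots$ be independent, identically distributed real random variables with $\mathbb{E}X_1=0$ and $\mathbb{E}X_1^2=1$. Put $S_0=0$, $S_n=X_1+\cdots+X_n$ and $T_n=\max(0,S_1,\dots,S_n)$. Let $u\ge 2$ be real with $\beta_u=\mathbb{E}|X_1|^u<\infty$. Consider the two conditions (C) $X_1$ has a density with respect to Lebesgue measure, and $\int_{\mathbb{R}}|\phi(t)|^{n_0}\,dt<\infty$ for some $n_0\in\mathbb{N}$, where $\phi(t)=\mathbb{E}e^{itX_1}$; (L) $X_1$ lies almost surely in a lattice $\{\gamma+m\lambda: m\in\mathbb{Z}\}$, where $\lambda>0$ is the maximal span (for no $\gamma'$ and no $\lambda'>\lambda$ does $X_1$ lie almost surely in $\{\gamma'+m\lambda':m\in\mathbb{Z}\}$); in this case put $\mathcal{L}_n=\{n\gamma+m\lambda:m\in\mathbb{Z}\}$. For $n\ge 1$ let $\widetilde R_n(x,y)=\frac{d}{dx}\mathbb{P}[T_{n-1}<y,\ S_n\le x]$ if (C) holds (this exists for almost every $x$), and $\widetilde R_n(x,y)=\mathbb{P}[T_{n-1}<y,\ S_n=x]$ if (L) holds. Then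 there is a constant $K$, depending only on $u$ and the distribution of $X_1$, such that for every $y\ge 0$ (with the convention $0^0=1$): - if (C) holds, then $\displaystyle\sum_{n=1}^\infty\int_0^\infty \xi^{u-2}\,\widetilde R_n(y+\xi,y)\,d\xi\le K$; - if (L) holds, then $\displaystyle\sum_{n=1}^\infty\ \sum_{\xi\ge 0,\ y+\xi\in\mathcal{L}_n}\xi^{u-2}\,\widetilde R_n(y+\xi,y)\le K$; - if (C) or (L) holds, then almost surely $S_n\ge y$ for some $n\ge 0$, and, with $\tau_y=\min\{n\ge 0: S_n\ge y\}$, the overshoot satisfies $\mathbb{E}\,(S_{\tau_y}-y)^{u-2}\le K$. -/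

import Mathlib

open MeasureTheory ProbabilityTheory
open scoped NNReal ENNReal

namespace BarrierWalk

noncomputable section

/-- The random walk `S_n`, the sum of the first `n` steps, with `S_0 = 0`. The steps are indexed
from `0`, so the first step is `X 0`. -/
def walk {Ω : Type*} (X : ℕ → Ω → ℝ) (n : ℕ) (ω : Ω) : ℝ :=
  ∑ i ∈ Finset.range n, X i ω

/-- The running maximum `T_n = max (0, S_1, …, S_n)`. -/
def walkMax {Ω : Type*} (X : ℕ → Ω → ℝ) (n : ℕ) (ω : Ω) : ℝ :=
  (Finset.range (n + 1)).sup' Finset.nonempty_range_add_one (fun k => walk X k ω)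

/-- The quantity `R̃_n(x, y)` for a continuous step distribution (used for `n ≥ 1`): the density
`d/dx P[T_{n-1} < y, S_n ≤ x]`. -/
def densR {Ω : Type*} [MeasurableSpace Ω] (P : Measure Ω) (X : ℕ → Ω → ℝ)
    (n : ℕ) (x y : ℝ) : ℝ :=
  deriv (fun t : ℝ => P.real {ω | walkMax X (n - 1) ω < y ∧ walk X n ω ≤ t}) x

/-- The quantity `R̃_n(x, y)` for a lattice step distribution (used for `n ≥ 1`):
the probability `P[T_{n-1} < y, S_n = x]`. -/
def massR {Ω : Type*} [MeasurableSpace Ω] (P : Measure Ω) (X : ℕ → Ω → ℝ)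
    (n : ℕ) (x y : ℝ) : ℝ :=
  P.real {ω | walkMax X (n - 1) ω < y ∧ walk X n ω = x}

/-- The time of first passage to `[y, ∞)`, i.e. the least `n ≥ 0` with `S_n ≥ y`
(and `0` if there is no such `n`). -/
def firstPassage {Ω : Type*} (X : ℕ → Ω → ℝ) (y : ℝ) (ω : Ω) : ℕ :=
  sInf {n : ℕ | y ≤ walk X n ω}

/-- Condition (C): the law has a density and some power of the modulus of its characteristic
function is integrable on the line. -/
def CondC (μ : Measure ℝ) : Prop :=
  μ ≪ volume ∧ ∃ n₀ : ℕ, Integrable (fun t : ℝ => ‖charFun μ t‖ ^ n₀) volume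

/-- The lattice `{n γ + m d : m ∈ ℤ}`. -/
def lattice (γ d : ℝ) (n : ℕ) : Set ℝ :=
  {x | ∃ m : ℤ, x = n * γ + m * d}

/-- Condition (L): the law is carried by the lattice `{γ + m d : m ∈ ℤ}`, where `d > 0` is its
maximal span. -/
def CondL (μ : Measure ℝ) (γ d : ℝ) : Prop :=
  0 < d ∧ μ (lattice γ d 1)ᶜ = 0 ∧ ∀ γ' d' : ℝ, d < d' → μ (lattice γ' d' 1)ᶜ ≠ 0

end

end BarrierWalk

/-! All three quantities are controlled by one sum over n of E[(S_{n+1} - y)_+^p ; T_n < y], with p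
= u - 2 and (t)_+^p read as 0 for t < 0. Split a path below y at a time m ≤ n where it attains its
maximum. The overshoot is then X_{n+1} - (y - S_m) - (S_m - S_n). If the two gaps lie in the j-th
and k-th intervals of length a, it is at most X_{n+1} - (j + k)a. The parts before m, between m and
n, and the last step are independent.

Ladder heights in an interval of length a are few (`tsum_ladderEvent_le`): a step larger than a
leaves the interval for good, so their expected number is at most 1/μ(a,∞). Time reversal
(`measure_stayEvent`) gives the same for the second part with the negated walk. Both bounds are free
of j, k and y. It remains to sum E(X - (j + k)a)_+^p over j, k (`tsum_overshootPow_le`). About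
(X/a)^2 pairs contribute, which costs exactly the moment of order p + 2 = u.

Passage above y is almost sure by the central limit theorem and Kolmogorov's zero-one law
(`ae_exists_le_walk`). -/

namespace BarrierWalk

/-! ### Path events and the σ-algebras of blocks of steps. -/

section Deterministic

variable {Ω : Type*} {X : ℕ → Ω → ℝ}

lemma walk_succ (X : ℕ → Ω → ℝ) (n : ℕ) (ω : Ω) : walk X (n + 1) ω = walk X n ω + X n ω :=
  Finset.sum_range_succ _ _

lemma walk_sub_eq_sum (X : ℕ → Ω → ℝ) {m n : ℕ} (h : m ≤ n) (ω : Ω) :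
    walk X n ω - walk X m ω = ∑ i ∈ Finset.Ico m n, X i ω :=
  (Finset.sum_Ico_eq_sub _ h).symm

lemma walkMax_lt_iff {n : ℕ} {ω : Ω} {y : ℝ} :
    walkMax X n ω < y ↔ ∀ k ≤ n, walk X k ω < y := by
  simp [walkMax, Finset.sup'_lt_iff]

/-- The σ-algebra generated by the steps with index in `s`. -/
abbrev stepAlgebra (X : ℕ → Ω → ℝ) (s : Set ℕ) : MeasurableSpace Ω :=
  ⨆ i ∈ s, MeasurableSpace.comap (X i) inferInstance

lemma stepAlgebra_mono {s t : Set ℕ} (h : s ⊆ t) : stepAlgebra X s ≤ stepAlgebra X t :=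
  biSup_mono h

lemma measurable_step {s : Set ℕ} {i : ℕ} (hi : i ∈ s) : Measurable[stepAlgebra X s] (X i) :=
  Measurable.mono (comap_measurable (X i))
    (le_iSup₂_of_le (f := fun i (_ : i ∈ s) => MeasurableSpace.comap (X i) inferInstance) i hi le_rfl)
    le_rfl

lemma measurable_walk_sub {s : Set ℕ} {m n : ℕ} (h : m ≤ n) (hs : Set.Ico m n ⊆ s) :
    Measurable[stepAlgebra X s] fun ω => walk X n ω - walk X m ω := by
  simp only [walk_sub_eq_sum X h]
  exact Finset.measurable_fun_sum _ fun i hi => measurable_step (hs (by simpa using hi))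

lemma measurable_walk_stepAlgebra {s : Set ℕ} {n : ℕ} (hs : Set.Iio n ⊆ s) :
    Measurable[stepAlgebra X s] (walk X n) := by
  unfold walk
  exact Finset.measurable_fun_sum _ fun i hi => measurable_step (hs (by simpa using hi))

/-- The event that `m` is a weak ascending ladder epoch with ladder height in `J`. -/
def ladderEvent (X : ℕ → Ω → ℝ) (m : ℕ) (J : Set ℝ) : Set Ω :=
  {ω | (∀ j ≤ m, walk X j ω ≤ walk X m ω) ∧ walk X m ω ∈ J}

/-- The event that the walk restarted at time `m` stays in `(-∞, 0]` for `l` steps and is in `K`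
at the end. -/
def stayEvent (X : ℕ → Ω → ℝ) (m l : ℕ) (K : Set ℝ) : Set Ω :=
  {ω | (∀ j ≤ l, walk X (m + j) ω - walk X m ω ≤ 0) ∧ walk X (m + l) ω - walk X m ω ∈ K}

lemma measurableSet_ladderEvent (m : ℕ) {J : Set ℝ} (hJ : MeasurableSet J) :
    MeasurableSet[stepAlgebra X (Set.Iio m)] (ladderEvent X m J) := by
  let _ : MeasurableSpace Ω := stepAlgebra X (Set.Iio m)
  have hw : ∀ k ≤ m, Measurable (walk X k) := fun k hk =>
    measurable_walk_stepAlgebra (Set.Iio_subset_Iio hk)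
  have : ladderEvent X m J =
      (⋂ j, ⋂ _ : j ≤ m, {ω | walk X j ω ≤ walk X m ω}) ∩ walk X m ⁻¹' J := by
    ext; simp [ladderEvent]
  rw [this]
  refine MeasurableSet.inter ?_ (hw m le_rfl hJ)
  exact .iInter fun j => .iInter fun hj => measurableSet_le (hw j hj) (hw m le_rfl)

lemma measurableSet_stayEvent (m l : ℕ) {K : Set ℝ} (hK : MeasurableSet K) :
    MeasurableSet[stepAlgebra X (Set.Ico m (m + l))] (stayEvent X m l K) := by
  let _ : MeasurableSpace Ω := stepAlgebra X (Set.Ico m (m + l))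
  have hw : ∀ k ≤ l, Measurable fun ω => walk X (m + k) ω - walk X m ω := fun k hk =>
    measurable_walk_sub (Nat.le_add_right _ _) (Set.Ico_subset_Ico_right (by omega))
  have : stayEvent X m l K = (⋂ j, ⋂ _ : j ≤ l, {ω | walk X (m + j) ω - walk X m ω ≤ 0}) ∩
      (fun ω => walk X (m + l) ω - walk X m ω) ⁻¹' K := by
    ext; simp [stayEvent]
  rw [this]
  refine MeasurableSet.inter ?_ (hw l le_rfl hK)
  exact .iInter fun j => .iInter fun hj => measurableSet_le (hw j hj) measurable_const

end Deterministic

/-! ### Independence of disjoint blocks; invariance of the law of the sequence. -/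

section Independence

variable {Ω : Type*} [MeasurableSpace Ω] {P : Measure Ω} {X : ℕ → Ω → ℝ}

/-- The steps `X i` are independent with common law `μ`. -/
structure IsIID (P : Measure Ω) (X : ℕ → Ω → ℝ) (μ : Measure ℝ) : Prop where
  measurable : ∀ i, Measurable (X i)
  indep : iIndepFun X P
  law : ∀ i, P.map (X i) = μ

lemma IsIID.precomp {μ : Measure ℝ} (h : IsIID P X μ) {σ : ℕ → ℕ} (hσ : σ.Injective) :
    IsIID P (fun i => X (σ i)) μ :=
  ⟨fun _ => h.measurable _, h.indep.precomp hσ, fun _ => h.law _⟩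

lemma IsIID.neg {μ : Measure ℝ} (h : IsIID P X μ) :
    IsIID P (fun i ω => -X i ω) (μ.map fun x => -x) := by
  refine ⟨fun i => (h.measurable i).neg, h.indep.comp (fun _ x => -x) fun _ => measurable_neg,
    fun i => ?_⟩
  rw [← h.law i, Measure.map_map measurable_neg (h.measurable i)]
  rfl

/-- Two i.i.d. sequences with the same step law have the same law on the sequence space. -/
lemma IsIID.measure_preimage_eq {μ : Measure ℝ} [IsProbabilityMeasure P] {Y : ℕ → Ω → ℝ}
    (hX : IsIID P X μ) (hY : IsIID P Y μ) {A : Set (ℕ → ℝ)} (hA : MeasurableSet A) :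
    P {ω | (fun i => X i ω) ∈ A} = P {ω | (fun i => Y i ω) ∈ A} := by
  have key : P.map (fun ω i => X i ω) = P.map (fun ω i => Y i ω) := by
    rw [hX.indep.map_fun_eq_infinitePi_map hX.measurable,
      hY.indep.map_fun_eq_infinitePi_map hY.measurable]
    simp only [hX.law, hY.law]
  have h1 := Measure.map_apply (μ := P) (measurable_pi_lambda _ hX.measurable) hA
  have h2 := Measure.map_apply (μ := P) (measurable_pi_lambda _ hY.measurable) hA
  rw [key] at h1
  exact h1.symm.trans h2

lemma stepAlgebra_le (hX : ∀ i, Measurable (X i)) (s : Set ℕ) :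
    stepAlgebra X s ≤ ‹MeasurableSpace Ω› :=
  iSup₂_le fun i _ => (hX i).comap_le

lemma lintegral_mul_stepAlgebra (hX : ∀ i, Measurable (X i)) (hind : iIndepFun X P)
    {s t : Set ℕ} (hst : Disjoint s t) {f g : Ω → ℝ≥0∞} (hf : Measurable[stepAlgebra X s] f)
    (hg : Measurable[stepAlgebra X t] g) :
    ∫⁻ ω, f ω * g ω ∂P = (∫⁻ ω, f ω ∂P) * ∫⁻ ω, g ω ∂P :=
  lintegral_mul_eq_lintegral_mul_lintegral_of_independent_measurableSpace
    (stepAlgebra_le hX s) (stepAlgebra_le hX t)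
    (indep_iSup_of_disjoint (fun i => (hX i).comap_le) hind hst) hf hg

lemma measure_inter_stepAlgebra (hX : ∀ i, Measurable (X i)) (hind : iIndepFun X P)
    {s t : Set ℕ} (hst : Disjoint s t) {A B : Set Ω} (hA : MeasurableSet[stepAlgebra X s] A)
    (hB : MeasurableSet[stepAlgebra X t] B) :
    P (A ∩ B) = P A * P B :=
  Indep_iff _ _ P |>.1 (indep_iSup_of_disjoint (fun i => (hX i).comap_le) hind hst) A B hA hB

lemma measurable_walk (hX : ∀ i, Measurable (X i)) (n : ℕ) : Measurable (walk X n) := by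
  unfold walk
  exact Finset.measurable_fun_sum _ fun i _ => hX i

lemma measurable_walkMax (hX : ∀ i, Measurable (X i)) (n : ℕ) : Measurable (walkMax X n) := by
  have : walkMax X n = (Finset.range (n + 1)).sup' Finset.nonempty_range_add_one
      (fun k => walk X k) := by
    ext ω
    simp [walkMax, Finset.sup'_apply]
  rw [this]
  exact Finset.measurable_sup' _ fun k _ => measurable_walk hX k

end Independence

/-! ### Counting ladder heights, and time reversal. -/

section Ladder

variable {Ω : Type*} [MeasurableSpace Ω] {P : Measure Ω} {X : ℕ → Ω → ℝ} {μ : Measure ℝ}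

/-- The expected number of ladder heights in a set of diameter at most `a` is at most
`1 / μ (a, ∞)`. -/
lemma tsum_ladderEvent_le [IsProbabilityMeasure P] (h : IsIID P X μ) {a : ℝ}
    {J : Set ℝ} (hJ : MeasurableSet J)
    (hw : ∀ s ∈ J, ∀ t ∈ J, s ≤ t + a) :
    ∑' m, P (ladderEvent X m J) ≤ (μ (Set.Ioi a))⁻¹ := by
  have hprob : IsProbabilityMeasure μ := by
    rw [← h.law 0]; exact Measure.isProbabilityMeasure_map (h.measurable 0).aemeasurable
  have hstep : ∀ m, P (ladderEvent X m J ∩ X m ⁻¹' Set.Ioi a) =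
      P (ladderEvent X m J) * μ (Set.Ioi a) := fun m => by
    rw [measure_inter_stepAlgebra h.measurable h.indep (s := Set.Iio m) (t := {m}) (by simp)
      (measurableSet_ladderEvent m hJ) (measurable_step (Set.mem_singleton m) measurableSet_Ioi),
      ← h.law m, Measure.map_apply (h.measurable m) measurableSet_Ioi]
  -- A later ladder epoch n has S_n ≥ S_{m+1} > S_m + a, which the diameter bound on `J` excludes.
  have hdisj : Pairwise (Function.onFun Disjoint
      fun m => ladderEvent X m J ∩ X m ⁻¹' Set.Ioi a) := by
    refine (pairwise_disjoint_on _).2 fun m n hmn => ?_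
    refine Set.disjoint_left.2 fun ω hm hn => ?_
    have h1 := hn.1.1 (m + 1) hmn
    have h2 := hw _ hn.1.2 _ hm.1.2
    have h3 : a < X m ω := hm.2
    rw [walk_succ] at h1
    linarith
  rw [ENNReal.le_inv_iff_mul_le, ← ENNReal.tsum_mul_right]
  simp only [← hstep]
  refine (tsum_meas_le_meas_iUnion_of_disjoint P (fun m => ?_) hdisj).trans prob_le_one
  exact (stepAlgebra_le h.measurable _ _ (measurableSet_ladderEvent m hJ)).inter
    (h.measurable m measurableSet_Ioi)

/-- Time reversal: the walk stays nonpositive exactly when the end time is a ladder epoch of the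
negated reversed walk. -/
lemma measure_stayEvent [IsProbabilityMeasure P] (h : IsIID P X μ) (m l : ℕ) {K : Set ℝ}
    (hK : MeasurableSet K) :
    P (stayEvent X m l K) = P (ladderEvent (fun i ω => -X i ω) l {s | -s ∈ K}) := by
  -- Reverses the block of `l` steps starting at `m`; beyond the block it only has to keep the map
  -- injective.
  set σ : ℕ → ℕ := fun i => m + if i < l then l - 1 - i else i with hσ
  have hinj : σ.Injective := fun i j hij => by
    simp only [hσ] at hij
    split_ifs at hij <;> omega
  have hwalk : ∀ ω, ∀ j ≤ l, walk (fun i ω => -X (σ i) ω) j ω =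
      walk X (m + (l - j)) ω - walk X (m + l) ω := fun ω j hj => by
    induction j with
    | zero => simp [walk]
    | succ j ih =>
      rw [walk_succ, ih (by omega), show m + (l - j) = m + (l - (j + 1)) + 1 by omega, walk_succ,
        show σ j = m + (l - (j + 1)) by simp only [hσ]; split_ifs <;> omega]
      ring
  have hset : stayEvent X m l K = ladderEvent (fun i ω => -X (σ i) ω) l {s | -s ∈ K} := by
    ext ω
    simp only [stayEvent, ladderEvent, Set.mem_ofPred_eq]
    rw [hwalk ω l le_rfl, Nat.sub_self, add_zero, neg_sub]
    refine and_congr_left fun _ => ⟨fun H j hj => ?_, fun H j hj => ?_⟩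
    · rw [hwalk ω j hj]
      linarith [H (l - j) (by omega)]
    · have := H (l - j) (by omega)
      rw [hwalk ω _ (by omega), show l - (l - j) = j by omega] at this
      linarith
  have hA : MeasurableSet (ladderEvent (fun i (x : ℕ → ℝ) => x i) l {s | -s ∈ K}) :=
    stepAlgebra_le (fun i => measurable_pi_apply i) _ _
      (measurableSet_ladderEvent l (measurable_neg hK))
  rw [hset]
  exact (h.precomp hinj).neg.measure_preimage_eq h.neg hA

end Ladder

end BarrierWalk

namespace BarrierWalk

/-! ### The overshoot moment, summed over passage times. -/

noncomputable section Overshoot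

/-- The function `t ↦ t ^ p` on `[0, ∞)`, extended by zero. -/
def overshootPow (p t : ℝ) : ℝ≥0∞ := if 0 ≤ t then ENNReal.ofReal (t ^ p) else 0

lemma overshootPow_of_nonneg {p t : ℝ} (ht : 0 ≤ t) : overshootPow p t = ENNReal.ofReal (t ^ p) :=
  if_pos ht

lemma overshootPow_mono {p : ℝ} (hp : 0 ≤ p) : Monotone (overshootPow p) := by
  intro s t hst
  unfold overshootPow
  split_ifs with hs ht
  · exact ENNReal.ofReal_le_ofReal (Real.rpow_le_rpow hs hst hp)
  · exact absurd (hs.trans hst) ht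
  · exact zero_le
  · exact le_rfl

lemma measurable_overshootPow (p : ℝ) : Measurable (overshootPow p) :=
  Measurable.ite measurableSet_Ici (by fun_prop) measurable_const

variable {Ω : Type*} {X : ℕ → Ω → ℝ}

/-- The starting positions whose distance below `y` lies in `[j a, (j + 1) a]`. -/
def bin (a y : ℝ) (j : ℕ) : Set ℝ := {s | j * a ≤ y - s ∧ y - s ≤ (j + 1) * a}

lemma measurableSet_bin (a y : ℝ) (j : ℕ) : MeasurableSet (bin a y j) :=
  .inter (measurableSet_le (f := fun _ => j * a) (g := fun s => y - s) (by fun_prop) (by fun_prop))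
    (measurableSet_le (f := fun s => y - s) (g := fun _ => (j + 1) * a) (by fun_prop) (by fun_prop))

lemma exists_mem_bin {a y s : ℝ} (ha : 0 < a) (hs : s ≤ y) : ∃ j, s ∈ bin a y j := by
  refine ⟨⌊(y - s) / a⌋₊, ?_, ?_⟩
  · have := Nat.floor_le (div_nonneg (sub_nonneg.2 hs) ha.le)
    exact (le_div_iff₀ ha).1 this
  · have := (Nat.lt_floor_add_one ((y - s) / a)).le
    exact (div_le_iff₀ ha).1 this

/-- Split the path below `y` at a time where it attains its maximum. -/
lemma exists_ladder_stay {p a y : ℝ} (hp : 0 ≤ p) (ha : 0 < a) {n : ℕ} {ω : Ω}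
    (h : walkMax X n ω < y) :
    ∃ m l, m + l = n ∧ ∃ j k : ℕ, ω ∈ ladderEvent X m (bin a y j) ∩ stayEvent X m l (bin a 0 k) ∧
      overshootPow p (walk X (n + 1) ω - y) ≤ overshootPow p (X n ω - (j + k) * a) := by
  rw [walkMax_lt_iff] at h
  obtain ⟨m, hm, hmax⟩ := Finset.exists_max_image (Finset.range (n + 1)) (fun k => walk X k ω)
    Finset.nonempty_range_add_one
  simp only [Finset.mem_range, Nat.lt_succ_iff] at hm hmax
  obtain ⟨l, rfl⟩ := Nat.exists_eq_add_of_le hm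
  obtain ⟨j, hj⟩ := exists_mem_bin ha (h m hm).le
  obtain ⟨k, hk⟩ := exists_mem_bin ha (sub_nonpos.2 (hmax (m + l) le_rfl))
  refine ⟨m, l, rfl, j, k, ⟨⟨fun i hi => hmax i (by omega), hj⟩,
    fun i hi => sub_nonpos.2 (hmax _ (by omega)), hk⟩, overshootPow_mono hp ?_⟩
  have h1 := hj.1
  have h2 := hk.1
  rw [walk_succ]
  linarith

variable [MeasurableSpace Ω] {P : Measure Ω} {μ : Measure ℝ}

/-- The three factors depend on the steps before `m`, those from `m` to `m + l - 1`, and step `m +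
l`. -/
lemma lintegral_ladder_stay (h : IsIID P X μ) (m l : ℕ)
    {J K : Set ℝ} (hJ : MeasurableSet J) (hK : MeasurableSet K) {f : ℝ → ℝ≥0∞}
    (hf : Measurable f) :
    ∫⁻ ω, (ladderEvent X m J ∩ stayEvent X m l K).indicator (fun ω => f (X (m + l) ω)) ω ∂P =
      P (ladderEvent X m J) * P (stayEvent X m l K) * ∫⁻ x, f x ∂μ := by
  have hL := measurableSet_ladderEvent (X := X) m hJ
  have hD := measurableSet_stayEvent (X := X) m l hK
  have hLD : MeasurableSet[stepAlgebra X (Set.Iio (m + l))]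
      (ladderEvent X m J ∩ stayEvent X m l K) :=
    MeasurableSet.inter (stepAlgebra_mono (Set.Iio_subset_Iio (by omega)) _ hL)
      (stepAlgebra_mono Set.Ico_subset_Iio_self _ hD)
  have hLD' := stepAlgebra_le h.measurable _ _ hLD
  have hone : Measurable[stepAlgebra X (Set.Iio (m + l))]
      ((ladderEvent X m J ∩ stayEvent X m l K).indicator (1 : Ω → ℝ≥0∞)) :=
    (@measurable_one ℝ≥0∞ Ω _ (stepAlgebra X (Set.Iio (m + l))) _).indicator hLD
  have hdisj : Disjoint (Set.Iio m) (Set.Ico m (m + l)) :=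
    Set.disjoint_left.2 fun i hi hi' => not_le_of_gt hi hi'.1
  calc ∫⁻ ω, (ladderEvent X m J ∩ stayEvent X m l K).indicator (fun ω => f (X (m + l) ω)) ω ∂P
      = ∫⁻ ω, (ladderEvent X m J ∩ stayEvent X m l K).indicator 1 ω * f (X (m + l) ω) ∂P := by
        refine lintegral_congr fun ω => ?_
        by_cases hω : ω ∈ ladderEvent X m J ∩ stayEvent X m l K <;> simp [hω]
    _ = (∫⁻ ω, (ladderEvent X m J ∩ stayEvent X m l K).indicator 1 ω ∂P) *
          ∫⁻ ω, f (X (m + l) ω) ∂P :=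
        lintegral_mul_stepAlgebra h.measurable h.indep (s := Set.Iio (m + l)) (t := {m + l})
          (by simp) hone
          (hf.comp (measurable_step (Set.mem_singleton _)))
    _ = _ := by
        rw [lintegral_indicator_one hLD', measure_inter_stepAlgebra h.measurable h.indep hdisj hL hD,
          ← h.law (m + l), lintegral_map hf (h.measurable _)]

/-- The contribution of the passage time `n + 1` to the overshoot moment. -/
def passageTerm (P : Measure Ω) (X : ℕ → Ω → ℝ) (p y : ℝ) (n : ℕ) : ℝ≥0∞ :=
  ∫⁻ ω in {ω | walkMax X n ω < y}, overshootPow p (walk X (n + 1) ω - y) ∂P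

/-- Neither the maximising time nor the bins (closed intervals sharing endpoints) need be unique;
overcounting is harmless for an upper bound. -/
lemma passageTerm_le [IsProbabilityMeasure P] (h : IsIID P X μ) {p a y : ℝ} (hp : 0 ≤ p)
    (ha : 0 < a) (n : ℕ) :
    passageTerm P X p y n ≤ ∑ q ∈ Finset.HasAntidiagonal.antidiagonal n, ∑' j : ℕ, ∑' k : ℕ,
      P (ladderEvent X q.1 (bin a y j)) *
        P (ladderEvent (fun i ω => -X i ω) q.2 {s | -s ∈ bin a 0 k}) *
        ∫⁻ x, overshootPow p (x - (j + k) * a) ∂μ := by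
  have hg : ∀ j k : ℕ, Measurable fun x : ℝ => overshootPow p (x - (j + k) * a) :=
    fun j k => (measurable_overshootPow p).comp (by fun_prop)
  set F : ℕ × ℕ → ℕ → ℕ → Ω → ℝ≥0∞ := fun q j k =>
    (ladderEvent X q.1 (bin a y j) ∩ stayEvent X q.1 q.2 (bin a 0 k)).indicator
      fun ω => overshootPow p (X (q.1 + q.2) ω - (j + k) * a) with hF
  have hFm : ∀ q j k, Measurable (F q j k) := fun q j k =>
    ((hg j k).comp (h.measurable _)).indicator
      ((stepAlgebra_le h.measurable _ _ (measurableSet_ladderEvent _ (measurableSet_bin a y j))).inter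
        (stepAlgebra_le h.measurable _ _ (measurableSet_stayEvent _ _ (measurableSet_bin a 0 k))))
  calc passageTerm P X p y n
      ≤ ∫⁻ ω, ∑ q ∈ Finset.HasAntidiagonal.antidiagonal n, ∑' j : ℕ, ∑' k : ℕ, F q j k ω ∂P := by
        rw [passageTerm, ← lintegral_indicator
          (measurableSet_lt (measurable_walkMax h.measurable n) measurable_const)]
        refine lintegral_mono fun ω => Set.indicator_apply_le' (fun hω => ?_) fun _ => zero_le
        obtain ⟨m, l, rfl, j, k, hmem, hle⟩ := exists_ladder_stay hp ha hω
        calc _ ≤ F (m, l) j k ω := by rw [hF]; simpa only [Set.indicator_of_mem hmem] using hle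
          _ ≤ ∑' k, F (m, l) j k ω := ENNReal.le_tsum k
          _ ≤ ∑' j, ∑' k, F (m, l) j k ω := ENNReal.le_tsum (f := fun j => ∑' k, F (m, l) j k ω) j
          _ ≤ _ := Finset.single_le_sum (f := fun q => ∑' j, ∑' k, F q j k ω)
              (fun _ _ => zero_le) (by simp)
    _ = ∑ q ∈ Finset.HasAntidiagonal.antidiagonal n, ∑' j : ℕ, ∑' k : ℕ, ∫⁻ ω, F q j k ω ∂P := by
        rw [lintegral_finsetSum _ fun q _ =>
          .tsum fun j => .tsum fun k => hFm q j k]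
        refine Finset.sum_congr rfl fun q _ => ?_
        rw [lintegral_tsum fun j => (Measurable.tsum fun k => hFm q j k).aemeasurable]
        exact tsum_congr fun j => lintegral_tsum fun k => (hFm q j k).aemeasurable
    _ ≤ _ := by
        refine (Finset.sum_congr rfl fun q _ => tsum_congr fun j => tsum_congr fun k => ?_).le
        rw [hF, ← measure_stayEvent h q.1 q.2 (measurableSet_bin a 0 k)]
        exact lintegral_ladder_stay h q.1 q.2 (measurableSet_bin a y j) (measurableSet_bin a 0 k)
          (hg j k)

lemma tsum_sum_antidiagonal (B : ℕ × ℕ → ℝ≥0∞) :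
    ∑' n, ∑ q ∈ Finset.HasAntidiagonal.antidiagonal n, B q = ∑' m, ∑' l, B (m, l) := by
  rw [← ENNReal.tsum_prod (f := fun m l => B (m, l)),
    ← Finset.HasAntidiagonal.sigmaAntidiagonalEquivProd.tsum_eq, ENNReal.tsum_sigma']
  refine tsum_congr fun n => ?_
  rw [tsum_fintype, ← Finset.sum_coe_sort]
  rfl

/-- The constant bounding the moment of the overshoot. -/
def overshootBound (μ : Measure ℝ) (p a : ℝ) : ℝ≥0∞ :=
  (μ (Set.Ioi a))⁻¹ * (μ (Set.Iio (-a)))⁻¹ *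
    ∑' j : ℕ, ∑' k : ℕ, ∫⁻ x, overshootPow p (x - (j + k) * a) ∂μ

/-- Summing over `n` frees `m` and `l`, so for fixed `j`, `k` the sum factors into two ladder
counts. Only the width of a bin enters their bounds, so `y` drops out. -/
lemma tsum_passageTerm_le [IsProbabilityMeasure P] (h : IsIID P X μ) {p a : ℝ} (hp : 0 ≤ p)
    (ha : 0 < a) (y : ℝ) :
    ∑' n, passageTerm P X p y n ≤ overshootBound μ p a := by
  have hup : ∀ j, ∑' m, P (ladderEvent X m (bin a y j)) ≤ (μ (Set.Ioi a))⁻¹ := fun j =>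
    tsum_ladderEvent_le h (measurableSet_bin a y j) fun s hs t ht => by
      linarith [hs.1, ht.2]
  have hdown : ∀ k, ∑' l, P (ladderEvent (fun i ω => -X i ω) l {s | -s ∈ bin a 0 k}) ≤
      (μ (Set.Iio (-a)))⁻¹ := fun k => by
    have := tsum_ladderEvent_le h.neg (a := a) (measurable_neg (measurableSet_bin a 0 k))
      fun s hs t ht => by
        have h1 := hs.2
        have h2 := ht.1
        linarith
    rwa [Measure.map_apply measurable_neg measurableSet_Ioi,
      show (fun x : ℝ => -x) ⁻¹' Set.Ioi a = Set.Iio (-a) by ext; simp] at this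
  calc ∑' n, passageTerm P X p y n
      ≤ ∑' n, ∑ q ∈ Finset.HasAntidiagonal.antidiagonal n, ∑' j : ℕ, ∑' k : ℕ,
          P (ladderEvent X q.1 (bin a y j)) *
          P (ladderEvent (fun i ω => -X i ω) q.2 {s | -s ∈ bin a 0 k}) *
          ∫⁻ x, overshootPow p (x - (j + k) * a) ∂μ :=
        ENNReal.tsum_le_tsum fun n => passageTerm_le h hp ha n
    _ = ∑' m, ∑' l, ∑' j : ℕ, ∑' k : ℕ, P (ladderEvent X m (bin a y j)) *
          P (ladderEvent (fun i ω => -X i ω) l {s | -s ∈ bin a 0 k}) *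
          ∫⁻ x, overshootPow p (x - (j + k) * a) ∂μ := tsum_sum_antidiagonal _
    _ = ∑' j : ℕ, ∑' k : ℕ, ∑' m, ∑' l, P (ladderEvent X m (bin a y j)) *
          P (ladderEvent (fun i ω => -X i ω) l {s | -s ∈ bin a 0 k}) *
          ∫⁻ x, overshootPow p (x - (j + k) * a) ∂μ := by
        calc _ = ∑' m, ∑' j : ℕ, ∑' l, ∑' k : ℕ, _ := tsum_congr fun m => ENNReal.tsum_comm
          _ = ∑' j : ℕ, ∑' m, ∑' k : ℕ, ∑' l, _ := by
            rw [ENNReal.tsum_comm]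
            exact tsum_congr fun j => tsum_congr fun m => ENNReal.tsum_comm
          _ = _ := tsum_congr fun j => ENNReal.tsum_comm
    _ ≤ ∑' j : ℕ, ∑' k : ℕ, (μ (Set.Ioi a))⁻¹ * (μ (Set.Iio (-a)))⁻¹ *
          ∫⁻ x, overshootPow p (x - (j + k) * a) ∂μ := by
        refine ENNReal.tsum_le_tsum fun j => ENNReal.tsum_le_tsum fun k => ?_
        simp only [ENNReal.tsum_mul_right, ENNReal.tsum_mul_left]
        gcongr
        exacts [hup j, hdown k]
    _ = overshootBound μ p a := by simp only [overshootBound, ENNReal.tsum_mul_left]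

/-- Nonzero terms need j + k ≤ x / a, so there are at most (x / a + 1)^2 of them, each at most x^p.
-/
lemma tsum_overshootPow_le {p a : ℝ} (hp : 0 ≤ p) (ha : 0 < a) (x : ℝ) :
    ∑' j : ℕ, ∑' k : ℕ, overshootPow p (x - (j + k) * a) ≤
      ENNReal.ofReal ((1 / a + 1) ^ 2 * (1 + |x| ^ (p + 2))) := by
  rcases lt_or_ge x 0 with hx | hx
  · have : ∀ j k : ℕ, overshootPow p (x - (j + k) * a) = 0 := fun j k => by
      have : (0 : ℝ) ≤ (j + k) * a := by positivity
      exact if_neg (by linarith)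
    simp [this]
  set N := ⌊x / a⌋₊ + 1 with hN
  have hout : ∀ j k : ℕ, ¬ (j < N ∧ k < N) → overshootPow p (x - (j + k) * a) = 0 :=
      fun j k hjk => by
    refine if_neg fun h0 => hjk ?_
    have h1 : ((j + k : ℕ) : ℝ) ≤ x / a := by
      rw [le_div_iff₀ ha]; push_cast; linarith
    have := Nat.le_floor h1
    omega
  have hin : ∀ j k : ℕ, overshootPow p (x - (j + k) * a) ≤ ENNReal.ofReal (x ^ p) := fun j k => by
    rw [← overshootPow_of_nonneg hx]
    have : (0 : ℝ) ≤ (j + k) * a := by positivity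
    exact overshootPow_mono hp (by linarith)
  have hNle : (N : ℝ) ≤ x / a + 1 := by
    rw [hN]; push_cast; gcongr; exact Nat.floor_le (by positivity)
  calc ∑' j : ℕ, ∑' k : ℕ, overshootPow p (x - (j + k) * a)
      = ∑ j ∈ Finset.range N, ∑ k ∈ Finset.range N, overshootPow p (x - (j + k) * a) := by
        rw [tsum_eq_sum (s := Finset.range N) fun j hj => by
          simp [hout j _ fun h => hj (Finset.mem_range.2 h.1)]]
        exact Finset.sum_congr rfl fun j _ => tsum_eq_sum fun k hk =>
          hout j k fun h => hk (Finset.mem_range.2 h.2)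
    _ ≤ ∑ j ∈ Finset.range N, ∑ k ∈ Finset.range N, ENNReal.ofReal (x ^ p) := by
        gcongr; exact hin _ _
    _ = ENNReal.ofReal ((N : ℝ) ^ 2 * x ^ p) := by
        rw [ENNReal.ofReal_mul (by positivity), ENNReal.ofReal_pow (by positivity)]
        simp [sq, mul_assoc]
    _ ≤ _ := by
        refine ENNReal.ofReal_le_ofReal ?_
        rw [abs_of_nonneg hx]
        rcases le_total x 1 with h1 | h1
        · have hxa : x / a ≤ 1 / a := by gcongr
          have h2 : x ^ p ≤ 1 := Real.rpow_le_one hx h1 hp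
          calc (N : ℝ) ^ 2 * x ^ p ≤ (1 / a + 1) ^ 2 * 1 := by gcongr; linarith
            _ ≤ _ := by gcongr; linarith [Real.rpow_nonneg hx (p + 2)]
        · have hxa : x / a + 1 ≤ (1 / a + 1) * x := by
            have : x / a = 1 / a * x := by ring
            nlinarith
          calc (N : ℝ) ^ 2 * x ^ p ≤ ((1 / a + 1) * x) ^ 2 * x ^ p := by gcongr; linarith
            _ = (1 / a + 1) ^ 2 * x ^ (p + 2) := by
              rw [Real.rpow_add (by linarith), Real.rpow_two]; ring
            _ ≤ _ := by gcongr; linarith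

lemma overshootBound_lt_top [IsProbabilityMeasure μ] {p a : ℝ} (hp : 0 ≤ p) (ha : 0 < a)
    (hup : μ (Set.Ioi a) ≠ 0) (hdown : μ (Set.Iio (-a)) ≠ 0)
    (hmom : Integrable (fun x : ℝ => |x| ^ (p + 2)) μ) : overshootBound μ p a < ⊤ := by
  have hg : ∀ j k : ℕ, Measurable fun x : ℝ => overshootPow p (x - (j + k) * a) :=
    fun j k => (measurable_overshootPow p).comp (by fun_prop)
  refine ENNReal.mul_lt_top (ENNReal.mul_lt_top (ENNReal.inv_lt_top.2 (pos_iff_ne_zero.2 hup))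
    (ENNReal.inv_lt_top.2 (pos_iff_ne_zero.2 hdown))) ?_
  calc _ = ∫⁻ x, ∑' j : ℕ, ∑' k : ℕ, overshootPow p (x - (j + k) * a) ∂μ := by
        rw [lintegral_tsum fun j => (Measurable.tsum fun k => hg j k).aemeasurable]
        exact tsum_congr fun j => (lintegral_tsum fun k => (hg j k).aemeasurable).symm
    _ ≤ ∫⁻ x, ENNReal.ofReal ((1 / a + 1) ^ 2 * (1 + |x| ^ (p + 2))) ∂μ :=
        lintegral_mono fun x => tsum_overshootPow_le hp ha x
    _ < ⊤ := (((integrable_const 1).add hmom).const_mul _).lintegral_lt_top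

end Overshoot

end BarrierWalk

namespace BarrierWalk

open Filter Topology

/-! ### Nondegenerate tails and almost sure passage. -/

section Hitting

/-- Otherwise f ≤ 0 almost everywhere, and a zero integral forces f = 0 almost everywhere. -/
lemma exists_measure_lt_ne_zero {α : Type*} [MeasurableSpace α] {μ : Measure α} {f : α → ℝ}
    (hf : Integrable f μ) (h0 : ∫ x, f x ∂μ = 0) (hne : ¬ f =ᵐ[μ] 0) :
    ∃ a > 0, μ {x | a < f x} ≠ 0 := by
  by_contra! H
  have hle : ∀ᵐ x ∂μ, f x ≤ 0 := by
    have : ∀ᵐ x ∂μ, ∀ n : ℕ, ¬ 1 / ((n : ℝ) + 1) < f x :=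
      ae_all_iff.2 fun n => by
        rw [ae_iff]; simpa using H (1 / ((n : ℝ) + 1)) (by positivity)
    filter_upwards [this] with x hx
    by_contra! hpos
    obtain ⟨n, hn⟩ := exists_nat_one_div_lt hpos
    exact hx n hn
  have h0' : ∫ x, -f x ∂μ = 0 := by rw [integral_neg, h0, neg_zero]
  have := (integral_eq_zero_iff_of_nonneg_ae (hle.mono fun x hx => by simpa using hx) hf.neg).1 h0'
  exact hne (this.mono fun x hx => by simpa using hx)

lemma exists_tails_ne_zero {μ : Measure ℝ} [IsProbabilityMeasure μ] (hmean : ∫ x, x ∂μ = 0)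
    (hvar : ∫ x, x ^ 2 ∂μ = 1) :
    ∃ a > 0, μ (Set.Ioi a) ≠ 0 ∧ μ (Set.Iio (-a)) ≠ 0 := by
  -- A non-integrable function has integral 0 by default, so variance 1 already gives integrability.
  have hsq : Integrable (fun x : ℝ => x ^ 2) μ := .of_integral_ne_zero (by rw [hvar]; simp)
  have hint : Integrable (fun x : ℝ => x) μ :=
    ((integrable_const (1 : ℝ)).add hsq).mono' (by fun_prop) <| .of_forall fun x => by
      rw [Real.norm_eq_abs, Pi.add_apply, ← sq_abs]
      nlinarith [sq_nonneg (|x| - 1), abs_nonneg x]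
  have hne : ¬ (fun x : ℝ => x) =ᵐ[μ] 0 := fun h => by
    have : (fun x : ℝ => x ^ 2) =ᵐ[μ] fun _ => 0 := h.mono fun x hx => by
      have : x = 0 := hx
      simp [this]
    rw [integral_congr_ae this] at hvar
    simp at hvar
  obtain ⟨a, ha, hμa⟩ := exists_measure_lt_ne_zero hint hmean hne
  obtain ⟨b, hb, hμb⟩ := exists_measure_lt_ne_zero (f := fun x => -x) hint.neg
    (by rw [integral_neg, hmean, neg_zero])
    fun h => hne (h.mono fun x hx => by simpa using hx)
  refine ⟨min a b, lt_min ha hb, fun h => hμa (measure_mono_null (fun x hx => ?_) h),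
    fun h => hμb (measure_mono_null (fun x hx => ?_) h)⟩
  · exact (min_le_left a b).trans_lt hx
  · have h1 : b < -x := hx
    have h2 := min_le_right a b
    rw [Set.mem_Iio]
    linarith

variable {Ω : Type*} {X : ℕ → Ω → ℝ}

/-- The event that the walk is unbounded above. -/
def unboundedEvent (X : ℕ → Ω → ℝ) : Set Ω := {ω | ∀ N : ℕ, ∃ n, (N : ℝ) ≤ walk X n ω}

/-- Dropping the first `k` steps shifts the path by a constant, so this is a tail event. A level
above the maximum up to time `k` can only be reached after `k`. -/
lemma unboundedEvent_eq (X : ℕ → Ω → ℝ) (k : ℕ) :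
    unboundedEvent X =
      ⋂ N : ℕ, ⋃ n, ⋃ _ : k ≤ n, {ω | (N : ℝ) ≤ walk X n ω - walk X k ω} := by
  ext ω
  simp only [unboundedEvent, Set.mem_ofPred_eq, Set.mem_iInter, Set.mem_iUnion, exists_prop]
  refine ⟨fun H N => ?_, fun H N => ?_⟩
  · obtain ⟨M, hM⟩ := exists_nat_gt (max (walkMax X k ω) (N + walk X k ω))
    obtain ⟨n, hn⟩ := H M
    rw [max_lt_iff, walkMax_lt_iff] at hM
    refine ⟨n, ?_, by linarith [hM.2]⟩
    by_contra! hlt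
    linarith [hM.1 n hlt.le]
  · obtain ⟨M, hM⟩ := exists_nat_gt (N - walk X k ω)
    obtain ⟨n, -, hn⟩ := H M
    exact ⟨n, by linarith⟩

lemma measurableSet_unboundedEvent (X : ℕ → Ω → ℝ) :
    MeasurableSet[limsup (fun i => MeasurableSpace.comap (X i) inferInstance) atTop]
      (unboundedEvent X) := by
  rw [limsup_eq_iInf_iSup_of_nat, MeasurableSpace.measurableSet_iInf]
  intro k
  have key : MeasurableSet[stepAlgebra X (Set.Ici k)] (unboundedEvent X) := by
    let _ : MeasurableSpace Ω := stepAlgebra X (Set.Ici k)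
    rw [unboundedEvent_eq X k]
    exact .iInter fun N => .iUnion fun n => .iUnion fun hn =>
      measurableSet_le measurable_const (measurable_walk_sub hn Set.Ico_subset_Ici_self)
  exact key

variable [MeasurableSpace Ω] {P : Measure Ω} {μ : Measure ℝ}

/-- Once √n ≥ N, the event S_n > √n forces passage above N, and the central limit theorem bounds its
probability below in the limit, uniformly in N. -/
lemma gaussianReal_Ioi_le_measure [IsProbabilityMeasure P] (h : IsIID P X μ)
    (hmean : ∫ x, x ∂μ = 0) (hvar : ∫ x, x ^ 2 ∂μ = 1) (N : ℕ) :
    gaussianReal 0 1 (Set.Ioi 1) ≤ P {ω | ∃ n, (N : ℝ) ≤ walk X n ω} := by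
  have hclt := tendstoInDistribution_inv_sqrt_mul_sum (P := P) (X := X)
    (P' := gaussianReal 0 1) (Y := id) ⟨aemeasurable_id, Measure.map_id⟩
    (by rw [← hmean, ← h.law 0, integral_map (h.measurable 0).aemeasurable (by fun_prop)])
    (by
      rw [← hvar, ← h.law 0, integral_map (h.measurable 0).aemeasurable (by fun_prop)]
      rfl)
    h.indep fun i => ⟨(h.measurable i).aemeasurable, (h.measurable 0).aemeasurable, by
      rw [h.law i, h.law 0]⟩
  have hlim := ProbabilityMeasure.le_liminf_measure_open_of_tendsto hclt.tendsto
    (isOpen_Ioi (a := (1 : ℝ)))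
  simp only [ProbabilityMeasure.coe_mk, Measure.map_id] at hlim
  refine hlim.trans ((liminf_le_liminf ?_).trans_eq (liminf_const (f := atTop (α := ℕ)) _))
  filter_upwards [eventually_ge_atTop (N ^ 2 + 1)] with n hn
  have hm : Measurable fun ω => (√(n : ℝ))⁻¹ * ∑ k ∈ Finset.range n, X k ω :=
    (measurable_walk h.measurable n).const_mul _
  rw [Measure.map_apply hm measurableSet_Ioi]
  refine measure_mono fun ω hω => ⟨n, ?_⟩
  have hω : 1 < (√(n : ℝ))⁻¹ * walk X n ω := hω
  have hN : (N : ℝ) ≤ √n := Real.le_sqrt_of_sq_le (by exact_mod_cast (Nat.le_succ _).trans hn)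
  have hpos : 0 < √(n : ℝ) := Real.sqrt_pos.2 (by exact_mod_cast (Nat.succ_pos _).trans_le hn)
  rw [inv_mul_eq_div, one_lt_div hpos] at hω
  exact hN.trans hω.le

/-- A centred walk with unit variance is almost surely unbounded above. -/
lemma ae_exists_le_walk [IsProbabilityMeasure P] (h : IsIID P X μ)
    (hmean : ∫ x, x ∂μ = 0) (hvar : ∫ x, x ^ 2 ∂μ = 1) :
    ∀ᵐ ω ∂P, ∀ y : ℝ, ∃ n, y ≤ walk X n ω := by
  have hpos : 0 < gaussianReal 0 1 (Set.Ioi 1) := by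
    refine pos_iff_ne_zero.2 fun h0 => ?_
    simpa using gaussianReal_absolutelyContinuous' 0 one_ne_zero h0
  have hE : unboundedEvent X = ⋂ N : ℕ, {ω | ∃ n, (N : ℝ) ≤ walk X n ω} := by
    ext; simp [unboundedEvent]
  have hlim : Tendsto (fun N : ℕ => P {ω | ∃ n, (N : ℝ) ≤ walk X n ω}) atTop
      (𝓝 (P (unboundedEvent X))) := by
    rw [hE]
    refine tendsto_measure_iInter_atTop (fun N => MeasurableSet.nullMeasurableSet ?_)
      (fun N M hNM ω ⟨n, hn⟩ => ⟨n, le_trans (by exact_mod_cast hNM) hn⟩)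
      ⟨0, measure_ne_top _ _⟩
    have : {ω | ∃ n, (N : ℝ) ≤ walk X n ω} = ⋃ n, {ω | (N : ℝ) ≤ walk X n ω} := by ext; simp
    rw [this]
    exact .iUnion fun n => measurableSet_le measurable_const (measurable_walk h.measurable n)
  have hP : 0 < P (unboundedEvent X) :=
    hpos.trans_le (ge_of_tendsto' hlim (gaussianReal_Ioi_le_measure h hmean hvar))
  have hone := (measure_zero_or_one_of_measurableSet_limsup_atTop
    (fun n => (h.measurable n).comap_le) h.indep (measurableSet_unboundedEvent X)).resolve_left
      hP.ne'
  have hae : ∀ᵐ ω ∂P, ω ∈ unboundedEvent X := by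
    refine (prob_compl_eq_zero_iff₀ (MeasurableSet.nullMeasurableSet ?_)).2 hone
    exact (limsup_le_iSup.trans (iSup_le fun n => (h.measurable n).comap_le)) _
      (measurableSet_unboundedEvent X)
  filter_upwards [hae] with ω hω y
  obtain ⟨N, hN⟩ := exists_nat_ge y
  obtain ⟨n, hn⟩ := hω N
  exact ⟨n, hN.trans hn⟩

end Hitting

/-! ### Densities, atoms and overshoots compared with the passage terms. -/

section Contributions

/-- The almost everywhere derivative of the distribution function is dominated by the measure. -/
lemma lintegral_mul_deriv_le (ν : Measure ℝ) [IsFiniteMeasure ν] {g : ℝ → ℝ≥0∞}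
    (hg : Measurable g) :
    ∫⁻ x, g x * ENNReal.ofReal (deriv (fun t => ν.real (Set.Iic t)) x) ≤ ∫⁻ x, g x ∂ν := by
  have hmono : Monotone fun t => ν.real (Set.Iic t) := fun s t hst =>
    measureReal_mono (Set.Iic_subset_Iic.2 hst)
  -- The Stieltjes function is built from right limits; right continuity of the distribution
  -- function identifies its measure with `ν`.
  have hright : ∀ x, Function.rightLim (fun t => ν.real (Set.Iic t)) x = ν.real (Set.Iic x) := by
    intro x
    have hcont : Tendsto (fun t => ν (Set.Iic t)) (𝓝[>] x) (𝓝 (ν (Set.Iic x))) := by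
      have hI : Set.Iic x = ⋂ t > x, Set.Iic t := by
        ext z
        simp only [Set.mem_Iic, Set.mem_iInter]
        exact ⟨fun hz t ht => hz.trans (le_of_lt ht), fun hz => le_of_forall_gt_imp_ge_of_dense hz⟩
      rw [hI]
      exact tendsto_measure_biInter_gt (fun t _ => measurableSet_Iic.nullMeasurableSet)
        (fun s t _ hst => Set.Iic_subset_Iic.2 hst) ⟨x + 1, by simp, measure_ne_top _ _⟩
    exact tendsto_nhds_unique (hmono.tendsto_rightLim x)
      ((ENNReal.tendsto_toReal (measure_ne_top _ _)).comp hcont)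
  have hν : hmono.stieltjesFunction.measure = ν := by
    refine Measure.ext_of_Ioc _ _ fun s t hst => ?_
    rw [StieltjesFunction.measure_Ioc, Monotone.stieltjesFunction_eq,
      Monotone.stieltjesFunction_eq, hright, hright, ← Set.Iic_sdiff_Iic,
      ← measureReal_sdiff (Set.Iic_subset_Iic.2 hst.le) measurableSet_Iic, ofReal_measureReal]
  calc ∫⁻ x, g x * ENNReal.ofReal (deriv (fun t => ν.real (Set.Iic t)) x)
      ≤ ∫⁻ x, g x * ν.rnDeriv volume x := by
        -- Almost everywhere the derivative is the density of the absolutely continuous part of `ν`;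
        -- the singular part is discarded.
        refine lintegral_mono_ae ?_
        filter_upwards [hmono.ae_hasDerivAt] with x hx
        rw [hx.deriv, hν]
        gcongr
        exact ENNReal.ofReal_toReal_le
    _ = ∫⁻ x, g x ∂(volume.withDensity (ν.rnDeriv volume)) := by
        rw [lintegral_withDensity_eq_lintegral_mul _ (Measure.measurable_rnDeriv _ _) hg]
        simp [mul_comm]
    _ ≤ ∫⁻ x, g x ∂ν := lintegral_mono' (Measure.withDensity_rnDeriv_le _ _) le_rfl

lemma tsum_mul_measure_singleton_le {ι : Type*} (ν : Measure ℝ) {g : ℝ → ℝ≥0∞}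
    {f : ι → ℝ} (hf : f.Injective) :
    ∑' i, g (f i) * ν {f i} ≤ ∫⁻ x, g x ∂ν := by
  have hs : ∀ i, ν.withDensity g {f i} = g (f i) * ν {f i} := fun i => by
    rw [withDensity_apply _ (measurableSet_singleton _), lintegral_singleton]
  simp only [← hs]
  refine (tsum_meas_le_meas_iUnion_of_disjoint _ (fun i => measurableSet_singleton (f i))
    fun i j hij => ?_).trans ((measure_mono (Set.subset_univ _)).trans_eq ?_)
  · simpa using hf.ne hij
  · rw [withDensity_apply _ MeasurableSet.univ, Measure.restrict_univ]

variable {Ω : Type*} {X : ℕ → Ω → ℝ}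

lemma overshoot_le_tsum {p y : ℝ} (hy : 0 < y) {ω : Ω} (h : ∃ n, y ≤ walk X n ω) :
    ENNReal.ofReal ((walk X (firstPassage X y ω) ω - y) ^ p) ≤
      ∑' n, {ω | walkMax X n ω < y}.indicator
        (fun ω => overshootPow p (walk X (n + 1) ω - y)) ω := by
  have hmem : y ≤ walk X (firstPassage X y ω) ω := Nat.sInf_mem (s := {n | y ≤ walk X n ω}) h
  have hlt : ∀ k < firstPassage X y ω, walk X k ω < y := fun k hk =>
    not_le.1 (Nat.notMem_of_lt_sInf (s := {n | y ≤ walk X n ω}) hk)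
  obtain ⟨n, hn⟩ : ∃ n, firstPassage X y ω = n + 1 := by
    refine Nat.exists_eq_succ_of_ne_zero fun h0 => ?_
    rw [h0] at hmem
    simp only [walk, Finset.range_zero, Finset.sum_empty] at hmem
    linarith
  rw [hn] at hmem hlt ⊢
  refine le_trans (le_of_eq ?_) (ENNReal.le_tsum n)
  have hω : ω ∈ {ω | walkMax X n ω < y} := walkMax_lt_iff.2 fun k hk => hlt k (by omega)
  rw [Set.indicator_of_mem hω, overshootPow_of_nonneg (sub_nonneg.2 hmem)]

variable [MeasurableSpace Ω] {P : Measure Ω}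

/-- The law of `S_{n+1}` on the event `T_n < y`. -/
noncomputable def killedLaw (P : Measure Ω) (X : ℕ → Ω → ℝ) (n : ℕ) (y : ℝ) : Measure ℝ :=
  (P.restrict {ω | walkMax X n ω < y}).map (walk X (n + 1))

instance [IsProbabilityMeasure P] (n : ℕ) (y : ℝ) : IsFiniteMeasure (killedLaw P X n y) := by
  unfold killedLaw; infer_instance

lemma killedLaw_apply (hX : ∀ i, Measurable (X i)) (n : ℕ) (y : ℝ) {A : Set ℝ}
    (hA : MeasurableSet A) :
    killedLaw P X n y A = P {ω | walkMax X n ω < y ∧ walk X (n + 1) ω ∈ A} := by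
  rw [killedLaw, Measure.map_apply (measurable_walk hX _) hA,
    Measure.restrict_apply (measurable_walk hX _ hA), Set.inter_comm]
  rfl

lemma measurable_overshootPow_sub (p y : ℝ) : Measurable fun x => overshootPow p (x - y) :=
  (measurable_overshootPow p).comp (measurable_id.sub_const y)

lemma lintegral_killedLaw (hX : ∀ i, Measurable (X i)) (p : ℝ) (n : ℕ) (y : ℝ) :
    ∫⁻ x, overshootPow p (x - y) ∂(killedLaw P X n y) = passageTerm P X p y n := by
  rw [killedLaw, lintegral_map (measurable_overshootPow_sub p y)
    (measurable_walk hX _), passageTerm]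

lemma lintegral_densR_le [IsProbabilityMeasure P] (hX : ∀ i, Measurable (X i)) (p : ℝ) (n : ℕ)
    (y : ℝ) :
    ∫⁻ ξ in Set.Ioi (0 : ℝ), ENNReal.ofReal (ξ ^ p * densR P X (n + 1) (y + ξ) y) ≤
      passageTerm P X p y n := by
  have hdens : ∀ x, densR P X (n + 1) x y =
      deriv (fun t => (killedLaw P X n y).real (Set.Iic t)) x := fun x => by
    simp only [densR, Measure.real, killedLaw_apply hX n y measurableSet_Iic]
    rfl
  calc _ ≤ ∫⁻ ξ in Set.Ioi (0 : ℝ), overshootPow p (y + ξ - y) *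
          ENNReal.ofReal (densR P X (n + 1) (y + ξ) y) := by
        refine setLIntegral_mono' measurableSet_Ioi fun ξ hξ => ?_
        have hξ : 0 < ξ := hξ
        rw [add_sub_cancel_left, overshootPow_of_nonneg hξ.le, ENNReal.ofReal_mul (by positivity)]
    _ ≤ ∫⁻ ξ, overshootPow p (y + ξ - y) * ENNReal.ofReal (densR P X (n + 1) (y + ξ) y) :=
        setLIntegral_le_lintegral _ _
    _ = ∫⁻ x, overshootPow p (x - y) * ENNReal.ofReal (densR P X (n + 1) x y) :=
        lintegral_add_left_eq_self
          (fun x => overshootPow p (x - y) * ENNReal.ofReal (densR P X (n + 1) x y)) y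
    _ ≤ ∫⁻ x, overshootPow p (x - y) ∂(killedLaw P X n y) := by
        simp only [hdens]
        exact lintegral_mul_deriv_le _ (measurable_overshootPow_sub p y)
    _ = passageTerm P X p y n := lintegral_killedLaw hX p n y

lemma tsum_massR_le [IsProbabilityMeasure P] (hX : ∀ i, Measurable (X i)) (p : ℝ) (n : ℕ)
    (y : ℝ) (L : Set ℝ) :
    ∑' ξ : {ξ : ℝ // y + ξ ∈ L ∧ 0 ≤ ξ},
        ENNReal.ofReal ((ξ : ℝ) ^ p * massR P X (n + 1) (y + ξ) y) ≤ passageTerm P X p y n := by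
  rw [← lintegral_killedLaw hX]
  refine le_trans (ENNReal.tsum_le_tsum fun ξ => ?_)
    (tsum_mul_measure_singleton_le (killedLaw P X n y)
      (f := fun ξ : {ξ : ℝ // y + ξ ∈ L ∧ 0 ≤ ξ} => y + ξ)
      fun a b hab => Subtype.ext (add_left_cancel hab))
  rw [add_sub_cancel_left, overshootPow_of_nonneg ξ.2.2,
    ENNReal.ofReal_mul (Real.rpow_nonneg ξ.2.2 p), killedLaw_apply hX n y (measurableSet_singleton _)]
  gcongr
  exact (ofReal_measureReal (measure_ne_top _ _)).le

/-- For y > 0 the passage time is some n + 1 with T_n < y. For y = 0 it is 0 and the overshoot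
vanishes; the extra 1 covers 0^0 = 1. -/
lemma lintegral_overshoot_le [IsProbabilityMeasure P] (hX : ∀ i, Measurable (X i)) {p y : ℝ}
    (hp : 0 ≤ p) (hy : 0 ≤ y) (h : ∀ᵐ ω ∂P, ∃ n, y ≤ walk X n ω) :
    ∫⁻ ω, ENNReal.ofReal ((walk X (firstPassage X y ω) ω - y) ^ p) ∂P ≤
      (∑' n, passageTerm P X p y n) + 1 := by
  have hmax : ∀ n, MeasurableSet {ω | walkMax X n ω < y} := fun n =>
    measurableSet_lt (measurable_walkMax hX n) measurable_const
  rcases hy.eq_or_lt with rfl | hy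
  · have hzero : ∀ ω, walk X (firstPassage X 0 ω) ω = 0 := fun ω => by
      have : firstPassage X 0 ω = 0 := Nat.sInf_eq_zero.2 (.inl (by simp [walk]))
      simp [this, walk]
    simp only [hzero, sub_self, lintegral_const, measure_univ, mul_one]
    refine le_add_left (ENNReal.ofReal_le_one.2 (Real.rpow_le_one le_rfl zero_le_one hp))
  · calc _ ≤ ∫⁻ ω, ∑' n, {ω | walkMax X n ω < y}.indicator
          (fun ω => overshootPow p (walk X (n + 1) ω - y)) ω ∂P :=
          lintegral_mono_ae (h.mono fun ω hω => overshoot_le_tsum hy hω)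
      _ = ∑' n, passageTerm P X p y n := by
          have hmeas : ∀ n, Measurable fun ω => overshootPow p (walk X (n + 1) ω - y) := fun n =>
            (measurable_overshootPow_sub p y).comp (measurable_walk hX (n + 1))
          rw [lintegral_tsum fun n => ((hmeas n).indicator (hmax n)).aemeasurable]
          exact tsum_congr fun n => lintegral_indicator (hmax n) _
      _ ≤ _ := le_self_add

end Contributions

end BarrierWalk

theorem mainTheorem6 (μ : Measure ℝ) [IsProbabilityMeasure μ]
    (hmean : ∫ x, x ∂μ = 0) (hvar : ∫ x, x ^ 2 ∂μ = 1)
    (u : ℝ) (hu : 2 ≤ u) (hmom : Integrable (fun x : ℝ => |x| ^ u) μ) :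
    ∃ C : ℝ≥0, ∀ (Ω : Type*) [MeasurableSpace Ω] (P : Measure Ω) [IsProbabilityMeasure P]
      (X : ℕ → Ω → ℝ), (∀ i, Measurable (X i)) → iIndepFun X P → (∀ i, P.map (X i) = μ) →
      ∀ y : ℝ, 0 ≤ y →
        (BarrierWalk.CondC μ →
          ∑' n : ℕ, ∫⁻ ξ in Set.Ioi (0 : ℝ),
            ENNReal.ofReal (ξ ^ (u - 2) * BarrierWalk.densR P X (n + 1) (y + ξ) y) ≤ C) ∧
        (∀ γ d : ℝ, BarrierWalk.CondL μ γ d →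
          ∑' n : ℕ, ∑' ξ : {ξ : ℝ // y + ξ ∈ BarrierWalk.lattice γ d (n + 1) ∧ 0 ≤ ξ},
            ENNReal.ofReal
              ((ξ : ℝ) ^ (u - 2) * BarrierWalk.massR P X (n + 1) (y + ξ) y) ≤ C) ∧
        ((BarrierWalk.CondC μ ∨ ∃ γ d : ℝ, BarrierWalk.CondL μ γ d) →
          (∀ᵐ ω ∂P, ∃ n : ℕ, y ≤ BarrierWalk.walk X n ω) ∧
          ∫⁻ ω, ENNReal.ofReal
            ((BarrierWalk.walk X (BarrierWalk.firstPassage X y ω) ω - y) ^ (u - 2)) ∂P ≤ C) := by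
  have hp : 0 ≤ u - 2 := sub_nonneg.2 hu
  -- The width `a` comes from `μ` alone, so the constant is fixed before the probability space and
  -- `y`.
  obtain ⟨a, ha, hup, hdown⟩ := BarrierWalk.exists_tails_ne_zero hmean hvar
  have hfin : BarrierWalk.overshootBound μ (u - 2) a + 1 ≠ ⊤ :=
    ENNReal.add_ne_top.2 ⟨(BarrierWalk.overshootBound_lt_top hp ha hup hdown
      (by simpa using hmom)).ne, ENNReal.one_ne_top⟩
  refine ⟨(BarrierWalk.overshootBound μ (u - 2) a + 1).toNNReal, ?_⟩
  intro Ω _ P _ X hX hind hlaw y hy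
  rw [ENNReal.coe_toNNReal hfin]
  have h : BarrierWalk.IsIID P X μ := ⟨hX, hind, hlaw⟩
  have hsum := BarrierWalk.tsum_passageTerm_le h hp ha y
  have hae : ∀ᵐ ω ∂P, ∃ n, y ≤ BarrierWalk.walk X n ω :=
    (BarrierWalk.ae_exists_le_walk h hmean hvar).mono fun ω hω => hω y
  refine ⟨fun _ => ?_, fun γ d _ => ?_, fun _ => ⟨hae, ?_⟩⟩
  · exact (ENNReal.tsum_le_tsum fun n => BarrierWalk.lintegral_densR_le hX (u - 2) n y).trans
      (hsum.trans le_self_add)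
  · exact (ENNReal.tsum_le_tsum fun n => BarrierWalk.tsum_massR_le hX (u - 2) n y _).trans
      (hsum.trans le_self_add)
  · exact (BarrierWalk.lintegral_overshoot_le hX hp hy hae).trans (by gcongr)
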